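/- Notation. Let $\mathcal P_n$ be the space of complex polynomials in one variable of degree at most $n$. For a compact set $K\subset\mathbb C$ and $g\in\mathcal C(K)$ (complex-valued continuous functions on $K$) let $\|g\|_K=\sup_K|g|$ and $\operatorname{dist}_K(g,\mathcal P_n)=\inf\{\|g-p\|_K : p\in\mathcal P_n\}$. Put $$s(K)=\Bigl\{g\in\mathcal C(K) : \lim_{n\to\infty}n^\ell\operatorname{dist}_K(g,\mathcal P_n)=0\ \text{ for every } \ell\in\{1,2,\dots\}\Bigr\},$$ and, for real $\ell\ge 0$ and $g\in\mathcal C(K)$, $$|g|_\ell=\|g\|_K+\sup_{n\ge 1}n^\ell\operatorname{dist}_K(g,\mathcal P_n)\in[0,\infty],$$ where the set $K$ is the domain of $g$. The set $K$ is polynomially convex if $K=\{z\in\mathbb C : |p(z)|\le\|p\|_K \text{ for every polynomial } p\}$. It is non-polar if its logarithmic capacity $\operatorname{cap}K=\sup_\mu\exp\bigl(-\iint\log\frac1{|z-w|}\,d\mu(z)\,d\mu(w)\bigr)$ is positive, where $\mu$ ranges over the Borel probability measures on $K$. Corollary 4.3. Let $E=A\cup B\subset\mathbb C$, where $A$ and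 $B$ are disjoint, compact, polynomially convex and non-polar. There is a constant $c\ge 1$, depending only on $A$ and $B$, such that for every $f\in\mathcal C(E)$ with $f|_A\in s(A)$ and $f|_B\in s(B)$ we have $f\in s(E)$ and $$|f|_\ell\ \le\ (c\ell)^\ell\,\bigl(|f|_A|_\ell+|f|_B|_\ell\bigr)\qquad\text{for all real }\ell\ge 1.$$ -/

import Mathlib

/-! Functions on a compact set `E ⊆ ℂ` are modelled by functions `f : ℂ → ℂ`; every notion below
only depends on the values of `f` on `E`. Norms and distances take values in `[0, ∞]`, so that an
infinite supremum is really infinite. -/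

namespace JacksonApprox

open scoped ENNReal Topology

/-- The supremum norm `‖f‖_E`, as an element of `[0, ∞]`. -/
noncomputable def supNorm (E : Set ℂ) (f : ℂ → ℂ) : ℝ≥0∞ :=
  ⨆ z ∈ E, ‖f z‖ₑ

/-- `dist_E(f, 𝒫_n)`: the infimum of `‖f - p‖_E` over the complex polynomials `p` of degree at
most `n` (the zero polynomial included). -/
noncomputable def polyDist (E : Set ℂ) (f : ℂ → ℂ) (n : ℕ) : ℝ≥0∞ :=
  ⨅ p ∈ Polynomial.degreeLE ℂ n, supNorm E (fun z => f z - p.eval z)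

/-- The class `s(E)`: continuous functions on `E` such that `n ^ ℓ * dist_E(f, 𝒫_n) → 0` for every
integer `ℓ ≥ 1`. -/
def s (E : Set ℂ) : Set (ℂ → ℂ) :=
  {f | ContinuousOn f E ∧ ∀ ℓ : ℕ, 1 ≤ ℓ →
    Filter.Tendsto (fun n : ℕ => (n : ℝ≥0∞) ^ ℓ * polyDist E f n) Filter.atTop (𝓝 0)}

/-- The Jackson norm `|f|_ℓ = ‖f‖_E + sup_{n ≥ 1} n ^ ℓ * dist_E(f, 𝒫_n)`, for real `ℓ ≥ 0`. -/
noncomputable def jacksonNorm (E : Set ℂ) (ℓ : ℝ) (f : ℂ → ℂ) : ℝ≥0∞ :=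
  supNorm E f + ⨆ n : ℕ, ⨆ _ : 1 ≤ n, (n : ℝ≥0∞) ^ ℓ * polyDist E f n

/-- The polynomial hull of `E`. -/
def polyHull (E : Set ℂ) : Set ℂ :=
  {z | ∀ p : Polynomial ℂ, ‖p.eval z‖ₑ ≤ supNorm E (fun w => p.eval w)}

/-- A set is polynomially convex if it equals its polynomial hull. -/
def IsPolynomiallyConvex (E : Set ℂ) : Prop :=
  E = polyHull E

/-- The logarithmic energy `∬ log (1 / |z - w|) dμ(z) dμ(w)`, written as the integral of the
positive part `log⁺ (1 / |z - w|)` (which is `∞` on the diagonal, since `ENNReal.log 0 = -∞`) minus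
that of the negative part `log⁺ |z - w|`. The latter integral is finite if `μ` is a finite measure
carried by a bounded set. -/
noncomputable def logEnergy (μ : MeasureTheory.Measure ℂ) : EReal :=
  ((∫⁻ z, ∫⁻ w, (-ENNReal.log (edist z w)).toENNReal ∂μ ∂μ : ℝ≥0∞) : EReal) -
    ((∫⁻ z, ∫⁻ w, (ENNReal.log (edist z w)).toENNReal ∂μ ∂μ : ℝ≥0∞) : EReal)

/-- The logarithmic capacity of a compact set `E`: the supremum of `exp (-I(μ))` over all Borel
probability measures `μ` carried by `E`, where `I(μ)` is the logarithmic energy. A compact set is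
polar exactly when its logarithmic capacity is zero. -/
noncomputable def logCapacity (E : Set ℂ) : ℝ≥0∞ :=
  ⨆ (μ : MeasureTheory.Measure ℂ) (_ : MeasureTheory.IsProbabilityMeasure μ) (_ : μ Eᶜ = 0),
    EReal.exp (-logEnergy μ)

end JacksonApprox

/-! Near-best approximants `p` on `A` and `q` on `B`, of degree at most `n`, are glued as `q + (p -
q) * H`, where the polynomial `H` has degree `O(n)`, is close to 1 on `A` and close to 0 on `B`. The
difficulty is that `q` may be huge on `A` and `p` on `B`. Positive capacity bounds this growth by `R
^ n` (`exists_norm_eval_le_pow_mul`), so it suffices that `H` errs by at most `2 * (2 * R)⁻¹ ^ n`.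

Such an `H` comes in two stages. One fixed polynomial `h` lies within `1 / (16 * R)` of the
indicator of `A` on `A ∪ B`. This is Runge approximation (`exists_polynomial_near_indicator`),
available because the complement of `A ∪ B` is connected: polynomial convexity makes each complement
connected by the maximum principle, and Janiszewski's theorem (`isPreconnected_compl_union`) passes
to the union. Composing `stepPoly n` with `h` then sharpens the fixed error to a geometric one, at a
degree linear in `n`.

Hence, for some `M` depending only on `A` and `B`, the distance on the union at degree `M * n` is at
most a constant times the distances on the pieces at degree `n`, plus a term of order `2⁻¹ ^ n`
(`exists_polyDist_union_le`). Since `n ^ ℓ * 2⁻¹ ^ n ≤ (2 * ℓ) ^ ℓ`, the geometric term is what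
produces the factor `(c * ℓ) ^ ℓ`. -/

namespace JacksonApprox

open scoped ENNReal Topology
open MeasureTheory

/-! ### Logarithmic potentials and the growth of polynomials -/

/-- The positive part of the logarithmic kernel. -/
noncomputable def logKernel (z w : ℂ) : ℝ≥0∞ := (-ENNReal.log (edist z w)).toENNReal

lemma measurable_logKernel : Measurable (Function.uncurry logKernel) := by
  unfold logKernel
  apply Measurable.ereal_toENNReal
  apply Measurable.neg
  exact ENNReal.measurable_log.comp measurable_edist

lemma logKernel_self (z : ℂ) : logKernel z z = ⊤ := by simp [logKernel]

lemma logKernel_of_ne {z w : ℂ} (h : z ≠ w) :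
    logKernel z w = ENNReal.ofReal (-Real.log (dist z w)) := by
  rw [logKernel, edist_dist, ENNReal.log_ofReal_of_pos (dist_pos.2 h), ← EReal.coe_neg,
    EReal.real_coe_toENNReal]

lemma one_le_exp_logKernel_mul_dist {z w : ℂ} (h : logKernel z w ≠ ⊤) :
    1 ≤ Real.exp (logKernel z w).toReal * dist z w := by
  have hne : z ≠ w := fun e => h (by rw [e, logKernel_self])
  have hp := dist_pos.2 hne
  rw [logKernel_of_ne hne, ENNReal.toReal_ofReal']
  calc (1 : ℝ) = Real.exp (-Real.log (dist z w)) * dist z w := by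
        rw [Real.exp_neg, Real.exp_log hp, inv_mul_cancel₀ hp.ne']
    _ ≤ _ := by gcongr; exact le_max_left _ _

/-- Serves to compare the potential at an arbitrary point with that at a nearest point of the
support, in place of a maximum principle for potentials. -/
lemma logKernel_le_of_dist_le {u v w : ℂ} (h : dist v w ≤ 2 * dist u w) :
    logKernel u w ≤ ENNReal.ofReal (Real.log 2) + logKernel v w := by
  by_cases hv : v = w
  · simp [hv, logKernel_self]
  have hp := dist_pos.2 hv
  have hu : 0 < dist u w := by linarith
  rw [logKernel_of_ne hv, logKernel_of_ne (dist_pos.1 hu)]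
  refine le_trans (ENNReal.ofReal_le_ofReal ?_) ENNReal.ofReal_add_le
  have := Real.log_le_log hp h
  rw [Real.log_mul two_ne_zero hu.ne'] at this
  linarith

/-- A bounded set of positive capacity carries a probability measure whose logarithmic energy is
finite. -/
lemma exists_measure_lintegral_logKernel_ne_top {B : Set ℂ} (hB : Bornology.IsBounded B)
    (hcap : 0 < logCapacity B) :
    ∃ μ : Measure ℂ, IsProbabilityMeasure μ ∧ μ Bᶜ = 0 ∧
      ∫⁻ z, ∫⁻ w, logKernel z w ∂μ ∂μ ≠ ⊤ := by
  simp only [logCapacity, lt_iSup_iff] at hcap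
  obtain ⟨μ, hμ, hμB, h⟩ := hcap
  refine ⟨μ, hμ, hμB, fun htop => ?_⟩
  have hae : ∀ᵐ z ∂μ, z ∈ B := by rw [ae_iff]; exact hμB
  -- On a bounded set the negative part of the kernel has finite integral, so an infinite positive
  -- part would force energy `⊤`, whose contribution to the capacity is 0.
  have hneg : ∫⁻ z, ∫⁻ w, (ENNReal.log (edist z w)).toENNReal ∂μ ∂μ ≠ ⊤ := by
    have hd : Metric.ediam B ≠ ⊤ := hB.ediam_ne_top
    set K := (ENNReal.log (Metric.ediam B)).toENNReal with hK
    have hKt : K ≠ ⊤ := by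
      rw [hK, EReal.toENNReal_ne_top_iff]
      simpa using hd
    refine ne_top_of_le_ne_top hKt ?_
    calc _ ≤ ∫⁻ z, ∫⁻ w, K ∂μ ∂μ := by
          refine lintegral_mono_ae (hae.mono fun z hz => lintegral_mono_ae (hae.mono fun w hw => ?_))
          exact EReal.toENNReal_le_toENNReal
            (ENNReal.log_monotone (Metric.edist_le_ediam_of_mem hz hw))
      _ = K := by simp
  have : logEnergy μ = ⊤ := by
    unfold logEnergy
    unfold logKernel at htop
    rw [htop]
    lift (∫⁻ z, ∫⁻ w, (ENNReal.log (edist z w)).toENNReal ∂μ ∂μ) to NNReal using hneg with a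
    exact EReal.top_sub_coe (a : ℝ)
  rw [this] at h
  simp at h

/-- A compact set of positive capacity carries a finite measure with bounded potential. -/
lemma exists_isCompact_lintegral_logKernel_le {B : Set ℂ} (hB : IsCompact B)
    (hcap : 0 < logCapacity B) :
    ∃ (μ : Measure ℂ) (F : Set ℂ) (M : ℝ≥0∞), IsProbabilityMeasure μ ∧ F ⊆ B ∧ IsCompact F ∧
      μ F ≠ 0 ∧ M ≠ ⊤ ∧ ∀ u, ∫⁻ w in F, logKernel u w ∂μ ≤ M := by
  obtain ⟨μ, hμ, hμB, hI⟩ := exists_measure_lintegral_logKernel_ne_top hB.isBounded hcap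
  have hmeas : Measurable fun z => ∫⁻ w, logKernel z w ∂μ :=
    measurable_logKernel.lintegral_prod_right'
  have hfin : ∀ᵐ z ∂μ, ∫⁻ w, logKernel z w ∂μ < ⊤ := ae_lt_top hmeas hI
  have hae : ∀ᵐ z ∂μ, z ∈ B := by rw [ae_iff]; exact hμB
  obtain ⟨n, hn⟩ : ∃ n : ℕ, μ (B ∩ {z | ∫⁻ w, logKernel z w ∂μ ≤ n}) ≠ 0 := by
    by_contra! hcon
    have h0 : μ (⋃ n : ℕ, B ∩ {z | ∫⁻ w, logKernel z w ∂μ ≤ n}) = 0 :=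
      measure_iUnion_null hcon
    have h1 : ∀ᵐ z ∂μ, z ∈ ⋃ n : ℕ, B ∩ {z | ∫⁻ w, logKernel z w ∂μ ≤ n} := by
      filter_upwards [hfin, hae] with z hz hzB
      obtain ⟨n, hn⟩ := ENNReal.exists_nat_gt hz.ne
      exact Set.mem_iUnion.2 ⟨n, hzB, hn.le⟩
    have : μ Set.univ = 0 := by
      rw [← Set.union_compl_self (⋃ n : ℕ, B ∩ {z | ∫⁻ w, logKernel z w ∂μ ≤ n})]
      exact measure_union_null h0 (by rwa [ae_iff] at h1)
    simp at this
  -- Inner regularity gives a compact set on which the potential is at most `n`; compactness is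
  -- needed for nearest points.
  obtain ⟨F, hFs, hF, hF0⟩ := (hB.measurableSet.inter (hmeas measurableSet_Iic)).exists_lt_isCompact
    (pos_iff_ne_zero.2 hn)
  have hFne : F.Nonempty := nonempty_of_measure_ne_zero hF0.ne'
  refine ⟨μ, F, ENNReal.ofReal (Real.log 2) + n, hμ, fun z hz => (hFs hz).1, hF, hF0.ne', by simp,
    fun u => ?_⟩
  obtain ⟨v, hv, hvu⟩ := hF.exists_infDist_eq_dist hFne u
  calc ∫⁻ w in F, logKernel u w ∂μ
      ≤ ∫⁻ w in F, (ENNReal.ofReal (Real.log 2) + logKernel v w) ∂μ := by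
        refine setLIntegral_mono' hF.measurableSet fun w hw => logKernel_le_of_dist_le ?_
        have h1 : dist u v ≤ dist u w := hvu ▸ Metric.infDist_le_dist_of_mem hw
        have := dist_triangle v u w
        rw [dist_comm v u] at this
        linarith
    _ ≤ ∫⁻ w, (ENNReal.ofReal (Real.log 2) + logKernel v w) ∂μ := setLIntegral_le_lintegral _ _
    _ = ENNReal.ofReal (Real.log 2) + ∫⁻ w, logKernel v w ∂μ := by
        rw [lintegral_add_left measurable_const]; simp
    _ ≤ _ := by gcongr; exact (hFs hv).2

lemma measurable_sum_logKernel (s : Multiset ℂ) :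
    Measurable fun w => (s.map fun u => logKernel u w).sum := by
  induction s using Multiset.induction_on with
  | empty => simp
  | cons u s ih =>
    simp only [Multiset.map_cons, Multiset.sum_cons]
    exact (measurable_logKernel.comp (measurable_const.prodMk measurable_id)).add ih

lemma setLIntegral_sum_logKernel_le {μ : Measure ℂ} {F : Set ℂ} {M : ℝ≥0∞}
    (h : ∀ u, ∫⁻ w in F, logKernel u w ∂μ ≤ M) (s : Multiset ℂ) :
    ∫⁻ w in F, (s.map fun u => logKernel u w).sum ∂μ ≤ s.card * M := by
  induction s using Multiset.induction_on with
  | empty => simp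
  | cons u s ih =>
    simp only [Multiset.map_cons, Multiset.sum_cons, Multiset.card_cons]
    rw [lintegral_add_right _ (measurable_sum_logKernel s), Nat.cast_add, add_mul, add_comm,
      Nat.cast_one, one_mul]
    exact add_le_add ih (h u)

lemma norm_eval_eq_mul_prod_dist (q : Polynomial ℂ) (x : ℂ) :
    ‖q.eval x‖ = ‖q.leadingCoeff‖ * (q.roots.map fun u => dist x u).prod := by
  have h := (IsAlgClosed.splits q).eq_prod_roots
  conv_lhs => rw [h]
  rw [Polynomial.eval_mul, Polynomial.eval_C, Polynomial.eval_multiset_prod, norm_mul,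
    Multiset.map_map]
  congr 1
  refine (Multiset.prod_hom _ (normHom : ℂ →*₀ ℝ)).symm.trans ?_
  rw [Multiset.map_map]
  simp [dist_eq_norm, Function.comp_def]

/-- For each root, `dist z u ≤ D + dist w u`, and `D` is absorbed through `1 ≤ exp (logKernel u w) *
dist w u`; the factors are then multiplied. -/
lemma prod_dist_le {z w : ℂ} {D : ℝ} (hD0 : 0 ≤ D) (hD : dist z w ≤ D) (s : Multiset ℂ)
    (hs : (s.map fun u => logKernel u w).sum ≠ ⊤) :
    (s.map fun u => dist z u).prod ≤
      (1 + D) ^ s.card * Real.exp ((s.map fun u => logKernel u w).sum).toReal *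
        (s.map fun u => dist w u).prod ∧ 0 ≤ (s.map fun u => dist z u).prod ∧
          0 ≤ (s.map fun u => dist w u).prod := by
  induction s using Multiset.induction_on with
  | empty => simp
  | cons u s ih =>
    simp only [Multiset.map_cons, Multiset.sum_cons, Multiset.card_cons, Multiset.prod_cons] at *
    rw [ENNReal.add_ne_top] at hs
    obtain ⟨h1, h2, h3⟩ := ih hs.2
    refine ⟨?_, by positivity, by positivity⟩
    have h4 := one_le_exp_logKernel_mul_dist hs.1
    have h5 : dist z u ≤ (1 + D) * Real.exp (logKernel u w).toReal * dist w u := by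
      rw [dist_comm u w] at h4
      have := dist_triangle z w u
      have h7 : dist w u ≤ Real.exp (logKernel u w).toReal * dist w u :=
        le_mul_of_one_le_left dist_nonneg (Real.one_le_exp ENNReal.toReal_nonneg)
      nlinarith
    rw [ENNReal.toReal_add hs.1 hs.2, Real.exp_add]
    calc _ ≤ ((1 + D) * Real.exp (logKernel u w).toReal * dist w u) * _ :=
          mul_le_mul h5 h1 h2 (by positivity)
      _ = _ := by ring

/-- A crude form of the Bernstein–Walsh inequality. -/
theorem exists_norm_eval_le_pow_mul {A B : Set ℂ} (hA : Bornology.IsBounded A) (hB : IsCompact B)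
    (hcap : 0 < logCapacity B) :
    ∃ R : ℝ, 1 ≤ R ∧ ∀ (n : ℕ) (q : Polynomial ℂ), q.natDegree ≤ n → ∀ z ∈ A,
      ∃ w ∈ B, ‖q.eval z‖ ≤ R ^ n * ‖q.eval w‖ := by
  obtain ⟨μ, F, M, hμ, hFB, hF, hF0, hM, hint⟩ := exists_isCompact_lintegral_logKernel_le hB hcap
  obtain ⟨D, hD0, hD⟩ : ∃ D : ℝ, 0 ≤ D ∧ ∀ z ∈ A, ∀ w ∈ F, dist z w ≤ D := by
    have := (hA.union hF.isBounded)
    refine ⟨Metric.diam (A ∪ F), Metric.diam_nonneg, fun z hz w hw =>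
      Metric.dist_le_diam_of_mem this (Or.inl hz) (Or.inr hw)⟩
  set K : ℝ := (M / μ F).toReal with hK
  have hKt : M / μ F ≠ ⊤ := ENNReal.div_ne_top hM hF0
  have hK0 : 0 ≤ K := ENNReal.toReal_nonneg
  refine ⟨(1 + D) * Real.exp K, ?_, fun n q hq z hz => ?_⟩
  · exact one_le_mul_of_one_le_of_one_le (by linarith) (Real.one_le_exp hK0)
  -- The point `w` depends on `q`: the kernel sum over the roots averages to at most `n * (M / μ F)`
  -- on `F`, so some point of `F` does no worse.
  have key : ∃ w ∈ F, (q.roots.map fun u => logKernel u w).sum ≤ n * (M / μ F) := by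
    obtain ⟨w, hw, hle⟩ := exists_le_setLAverage hF0 (measure_ne_top μ F)
      (measurable_sum_logKernel q.roots).aemeasurable
    refine ⟨w, hw, hle.trans ?_⟩
    rw [setLAverage_eq, mul_div_assoc']
    gcongr
    refine (setLIntegral_sum_logKernel_le hint q.roots).trans ?_
    gcongr
    exact (Polynomial.card_roots' q).trans hq
  obtain ⟨w, hw, hsum⟩ := key
  refine ⟨w, hFB hw, ?_⟩
  have hnt : (n : ℝ≥0∞) * (M / μ F) ≠ ⊤ := ENNReal.mul_ne_top (by simp) hKt
  obtain ⟨h1, h2, h3⟩ := prod_dist_le hD0 (hD z hz w hw) q.roots (ne_top_of_le_ne_top hnt hsum)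
  have h4 : ((q.roots.map fun u => logKernel u w).sum).toReal ≤ n * K := by
    refine (ENNReal.toReal_mono hnt hsum).trans ?_
    simp [hK]
  rw [norm_eval_eq_mul_prod_dist, norm_eval_eq_mul_prod_dist, mul_pow, ← Real.exp_nat_mul]
  calc _ ≤ ‖q.leadingCoeff‖ * ((1 + D) ^ q.roots.card *
          Real.exp ((q.roots.map fun u => logKernel u w).sum).toReal *
          (q.roots.map fun u => dist w u).prod) := by gcongr
    _ ≤ ‖q.leadingCoeff‖ * ((1 + D) ^ n * Real.exp (n * K) *
          (q.roots.map fun u => dist w u).prod) := by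
        gcongr
        · linarith
        · exact (Polynomial.card_roots' q).trans hq
    _ = _ := by ring

/-! ### Connectedness of complements in the plane -/

lemma isPreconnected_setOf_lt_norm (r : ℝ) : IsPreconnected {z : ℂ | max r 0 < ‖z‖} := by
  rcases le_or_gt r 0 with hr | hr
  · have : {z : ℂ | max r 0 < ‖z‖} = {0}ᶜ := by
      ext z; simp [max_eq_right hr]
    rw [this]
    exact (isConnected_compl_singleton_of_one_lt_rank (by simp) 0).isPreconnected
  · have : {z : ℂ | max r 0 < ‖z‖} = Complex.exp '' {w | Real.log r < w.re} := by
      ext z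
      simp only [max_eq_left hr.le, Set.mem_ofPred_eq, Set.mem_image]
      constructor
      · intro h
        have hz : z ≠ 0 := norm_pos_iff.1 (hr.trans h)
        exact ⟨Complex.log z, by rw [Complex.log_re]; exact Real.log_lt_log hr h,
          Complex.exp_log hz⟩
      · rintro ⟨w, hw, rfl⟩
        rw [Complex.norm_exp]
        exact (Real.log_lt_iff_lt_exp hr).1 hw
    rw [this]
    exact ((convex_halfSpace_re_gt _).isPreconnected).image _ Complex.continuous_exp.continuousOn

/-- The maximum principle: an open set whose frontier lies in `A` is contained in the polynomial
hull of `A` if it is bounded. -/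
lemma subset_polyHull_of_frontier_subset {A U : Set ℂ} (hU : Bornology.IsBounded U)
    (hf : frontier U ⊆ A) : U ⊆ polyHull A := by
  intro z hz p
  by_cases htop : supNorm A (fun w => p.eval w) = ⊤
  · rw [htop]; exact le_top
  rw [← ofReal_norm, ENNReal.ofReal_le_iff_le_toReal htop]
  refine Complex.norm_le_of_forall_mem_frontier_norm_le (f := fun w => p.eval w) hU
    p.differentiable.diffContOnCl (fun w hw => ?_) (subset_closure hz)
  rw [← ENNReal.ofReal_le_iff_le_toReal htop, ofReal_norm]
  exact le_iSup₂ (f := fun (z : ℂ) (_ : z ∈ A) => ‖p.eval z‖ₑ) w (hf hw)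

/-- A compact polynomially convex set has connected complement. -/
theorem isPreconnected_compl_of_isPolynomiallyConvex {A : Set ℂ} (hA : IsCompact A)
    (hconv : IsPolynomiallyConvex A) : IsPreconnected Aᶜ := by
  obtain ⟨r, hr⟩ := hA.isBounded.subset_closedBall 0
  have hext : {z : ℂ | max r 0 < ‖z‖} ⊆ Aᶜ := fun z hz hzA => by
    have := hr hzA
    rw [mem_closedBall_zero_iff] at this
    exact absurd ((le_max_left r 0).trans_lt hz) (not_lt.2 this)
  -- If `v` contains the exterior of a disc, the part of `Aᶜ` in `u` is bounded with frontier in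
  -- `A`. The maximum principle puts it in the hull of `A`, which is `A`, so it is empty.
  have key : ∀ u v : Set ℂ, IsOpen u → IsOpen v → Aᶜ ⊆ u ∪ v → Aᶜ ∩ (u ∩ v) = ∅ →
      {z : ℂ | max r 0 < ‖z‖} ⊆ v → Aᶜ ⊆ v := by
    intro u v hu hv huv hdisj hv'
    have hbd : Bornology.IsBounded (Aᶜ ∩ u) := by
      refine (Metric.isBounded_closedBall (x := (0 : ℂ)) (r := max r 0)).subset fun z hz => ?_
      rw [mem_closedBall_zero_iff]
      by_contra! hlt
      exact Set.eq_empty_iff_forall_notMem.1 hdisj z ⟨hz.1, hz.2, hv' hlt⟩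
    have hfr : frontier (Aᶜ ∩ u) ⊆ A := by
      intro x hx
      rw [(hA.isClosed.isOpen_compl.inter hu).frontier_eq] at hx
      by_contra hxA
      rcases huv hxA with h | h
      · exact hx.2 ⟨hxA, h⟩
      · obtain ⟨y, hy1, hy2⟩ := mem_closure_iff.1 hx.1 v hv h
        exact Set.eq_empty_iff_forall_notMem.1 hdisj y ⟨hy2.1, hy2.2, hy1⟩
    have hsub := subset_polyHull_of_frontier_subset hbd hfr
    rw [← hconv] at hsub
    intro z hz
    exact (huv hz).resolve_left fun h => hz (hsub ⟨hz, h⟩)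
  rw [isPreconnected_iff_subset_of_disjoint]
  intro u v hu hv huv hdisj
  have h1 := isPreconnected_iff_subset_of_disjoint.1 (isPreconnected_setOf_lt_norm r) u v hu hv
    (hext.trans huv) (Set.subset_eq_empty (Set.inter_subset_inter_left _ hext) hdisj)
  rcases h1 with h | h
  · exact Or.inl (key v u hv hu (by rwa [Set.union_comm]) (by rwa [Set.inter_comm v u]) h)
  · exact Or.inr (key u v hu hv huv hdisj h)

/-- The kernel of `ℝ → ℝ/ℤ` is the discrete set of integers, where a continuous image of a
preconnected set is a single point. -/
lemma exists_eqOn_const_of_coe_addCircle_eq_zero {S : Set ℂ} (hS : IsPreconnected S) {f : ℂ → ℝ}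
    (hf : ContinuousOn f S) (h0 : ∀ z ∈ S, (f z : AddCircle (1 : ℝ)) = 0) :
    ∃ c, ∀ z ∈ S, f z = c := by
  rcases S.eq_empty_or_nonempty with rfl | ⟨z₀, hz₀⟩
  · exact ⟨0, by simp⟩
  refine ⟨f z₀, fun z hz => ?_⟩
  have hd : IsDiscrete (Set.range ((↑) : ℤ → ℝ)) :=
    ⟨Int.isClosedEmbedding_coe_real.isEmbedding.toHomeomorph.symm.isEmbedding.discreteTopology⟩
  refine hS.constant_of_mapsTo hd hf (fun x hx => ?_) hz hz₀
  obtain ⟨n, hn⟩ := (AddCircle.coe_eq_zero_iff (1 : ℝ)).1 (h0 x hx)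
  exact ⟨n, by simpa using hn⟩

open Classical in
/-- Janiszewski's theorem for two disjoint closed sets in the plane. -/
theorem isPreconnected_compl_union {A B : Set ℂ} (hA : IsClosed A) (hB : IsClosed B)
    (hAB : Disjoint A B) (hA' : IsPreconnected Aᶜ) (hB' : IsPreconnected Bᶜ) :
    IsPreconnected (A ∪ B)ᶜ := by
  rw [isPreconnected_iff_subset_of_disjoint]
  intro u v hu hv huv hdisj
  have hEo : IsOpen (A ∪ B)ᶜ := (hA.union hB).isOpen_compl
  obtain ⟨χ, hχB, hχA, -⟩ := exists_contMDiffMap_zero_one_nhds_of_isClosed (n := 0)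
    (modelWithCornersSelf ℝ ℂ) hB hA hAB.symm
  have hχ : Continuous χ := χ.contMDiff.continuous
  rw [Filter.eventually_iff, mem_nhdsSet_iff_forall] at hχA hχB
  -- A separation of the complement gives this locally constant 0-1 function. As `χ` is 1 near `A`
  -- and 0 near `B`, `(1 - χ) * g` is continuous off `B` and `-χ * g` off `A`. They differ by the
  -- integer `g`, hence define one continuous map from the plane to the circle.
  set g : ℂ → ℝ := fun z => if z ∈ (A ∪ B)ᶜ ∩ u then 1 else 0 with hg
  have hguv : ∀ z ∈ (A ∪ B)ᶜ, ∀ᶠ w in 𝓝 z, g w = g z := by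
    intro z hz
    rcases huv hz with h | h
    · filter_upwards [(hEo.inter hu).mem_nhds ⟨hz, h⟩] with w hw
      simp only [hg]
      rw [if_pos hw, if_pos ⟨hz, h⟩]
    · have hn : ∀ w ∈ (A ∪ B)ᶜ ∩ v, g w = 0 := fun w hw => if_neg fun hw' =>
        Set.eq_empty_iff_forall_notMem.1 hdisj w ⟨hw.1, hw'.2, hw.2⟩
      filter_upwards [(hEo.inter hv).mem_nhds ⟨hz, h⟩] with w hw
      rw [hn w hw, hn z ⟨hz, h⟩]
  have hgc : ∀ z ∈ (A ∪ B)ᶜ, ContinuousAt g z := fun z hz =>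
    (continuousAt_const (y := g z)).congr ((hguv z hz).mono fun w hw => hw.symm)
  have hgcoe : ∀ z, (g z : AddCircle (1 : ℝ)) = 0 := by
    intro z
    simp only [hg]
    split_ifs
    · exact AddCircle.coe_period 1
    · simp
  have hcA : ∀ z ∈ A, ContinuousAt (fun z => (1 - χ z) * g z) z := fun z hz =>
    (continuousAt_const (y := (0 : ℝ))).congr ((show ∀ᶠ w in 𝓝 z, χ w = 1 from hχA z hz).mono
      fun w hw => by simp [hw])
  have hcB : ∀ z ∈ B, ContinuousAt (fun z => χ z * g z) z := fun z hz =>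
    (continuousAt_const (y := (0 : ℝ))).congr ((show ∀ᶠ w in 𝓝 z, χ w = 0 from hχB z hz).mono
      fun w hw => by simp [hw])
  have hsplit : ∀ z, z ∈ (A ∪ B)ᶜ ∨ z ∈ A ∨ z ∈ B := fun z => by
    by_cases h : z ∈ A ∪ B
    · exact Or.inr h
    · exact Or.inl h
  have hcoe_eq : ∀ z, (((1 - χ z) * g z : ℝ) : AddCircle (1 : ℝ)) = ((-(χ z * g z) : ℝ)) := by
    intro z
    rw [show (1 - χ z) * g z = -(χ z * g z) + g z by ring, AddCircle.coe_add, hgcoe, add_zero]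
  have hcB' : ∀ z, z ∉ B → ContinuousAt (fun z => (1 - χ z) * g z) z := fun z hz => by
    rcases hsplit z with h | h | h
    · exact (continuousAt_const.sub hχ.continuousAt).mul (hgc z h)
    · exact hcA z h
    · exact absurd h hz
  have hcA' : ∀ z, z ∉ A → ContinuousAt (fun z => χ z * g z) z := fun z hz => by
    rcases hsplit z with h | h | h
    · exact hχ.continuousAt.mul (hgc z h)
    · exact absurd h hz
    · exact hcB z h
  have hΦ : Continuous fun z => (((1 - χ z) * g z : ℝ) : AddCircle (1 : ℝ)) := by
    rw [continuous_iff_continuousAt]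
    intro z
    by_cases hz : z ∈ B
    · have hzA : z ∉ A := fun h => Set.disjoint_left.1 hAB h hz
      simp only [hcoe_eq]
      exact (AddCircle.continuous_mk' (1 : ℝ)).continuousAt.comp (hcA' z hzA).neg
    · exact (AddCircle.continuous_mk' (1 : ℝ)).continuousAt.comp (hcB' z hz)
  obtain ⟨x₀, hx₀⟩ := QuotientAddGroup.mk_surjective
    (((1 - χ 0) * g 0 : ℝ) : AddCircle (1 : ℝ))
  -- The plane is simply connected, so the circle map lifts to `ℝ`. Comparing the lift with either
  -- local formula leaves a constant, `c` or `d`, and subtracting makes `g` constant.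
  obtain ⟨F, ⟨-, hF⟩, -⟩ := (AddCircle.isCoveringMap_coe (1 : ℝ)).existsUnique_continuousMap_lifts
    ⟨_, hΦ⟩ 0 x₀ hx₀
  have hF' : ∀ z, (F z : AddCircle (1 : ℝ)) = (((1 - χ z) * g z : ℝ)) := fun z => congrFun hF z
  obtain ⟨c, hc⟩ := exists_eqOn_const_of_coe_addCircle_eq_zero hB'
    (f := fun z => F z - (1 - χ z) * g z)
    (fun z hz => (F.continuous.continuousAt.sub (hcB' z hz)).continuousWithinAt)
    (fun z _ => by rw [AddCircle.coe_sub, hF', sub_self])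
  obtain ⟨d, hd⟩ := exists_eqOn_const_of_coe_addCircle_eq_zero hA'
    (f := fun z => F z + χ z * g z)
    (fun z hz => (F.continuous.continuousAt.add (hcA' z hz)).continuousWithinAt)
    (fun z _ => by rw [AddCircle.coe_add, hF', hcoe_eq, AddCircle.coe_neg, neg_add_cancel])
  have hconst : ∀ z ∈ (A ∪ B)ᶜ, g z = d - c := fun z hz => by
    have h1 := hc z fun h => hz (Or.inr h)
    have h2 := hd z fun h => hz (Or.inl h)
    linear_combination h2 - h1
  by_cases h : d - c = 1
  · left
    intro z hz
    by_contra hzu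
    have h1 : g z = 0 := if_neg fun h' => hzu h'.2
    linarith [hconst z hz]
  · right
    intro z hz
    refine (huv hz).resolve_left fun hzu => h ?_
    rw [← hconst z hz]
    exact if_pos ⟨hz, hzu⟩

/-! ### The Cauchy–Pompeiu formula -/

/-- The Wirtinger derivative with respect to the conjugate variable. -/
noncomputable def dbar (g : ℂ → ℂ) (z : ℂ) : ℂ :=
  (1 / 2) * (fderiv ℝ g z 1 + Complex.I * fderiv ℝ g z Complex.I)

/-- Rotating the frame `1, I` by a unit vector `e` gives the polar form of the operator, splitting
it into radial and angular derivatives. -/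
lemma dbar_div_eq (g : ℂ → ℂ) (z e : ℂ) (he : e * (starRingEnd ℂ) e = 1) :
    dbar g z / e = (1 / 2) * (fderiv ℝ g z e + Complex.I * fderiv ℝ g z (e * Complex.I)) := by
  have he0 : e ≠ 0 := fun h => by simp [h] at he
  have h1 : ∀ v : ℂ, fderiv ℝ g z v = v.re * fderiv ℝ g z 1 + v.im * fderiv ℝ g z Complex.I := by
    intro v
    conv_lhs => rw [show v = v.re • (1 : ℂ) + v.im • Complex.I by simp]
    rw [map_add, map_smul, map_smul, Complex.real_smul, Complex.real_smul]
  have h2 : e * ((e.re : ℂ) - e.im * Complex.I) = 1 := by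
    rw [← he]; congr 1; apply Complex.ext <;> simp
  rw [div_eq_iff he0, h1 e, h1 (e * Complex.I), dbar]
  simp only [Complex.mul_re, Complex.mul_im, Complex.I_re, Complex.I_im, mul_zero, mul_one,
    zero_sub, add_zero, Complex.ofReal_neg]
  linear_combination (-(1 / 2) * (fderiv ℝ g z 1 + Complex.I * fderiv ℝ g z Complex.I)) * h2 +
    (-(1 / 2) * e * e.im * fderiv ℝ g z Complex.I) * Complex.I_mul_I

lemma continuous_dbar {g : ℂ → ℂ} (hg : ContDiff ℝ 1 g) : Continuous (dbar g) := by
  have := hg.continuous_fderiv one_ne_zero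
  unfold dbar
  fun_prop

lemma tsupport_dbar_subset (g : ℂ → ℂ) : tsupport (dbar g) ⊆ tsupport g := by
  refine closure_minimal (fun z hz => ?_) (isClosed_tsupport g)
  by_contra h
  have : fderiv ℝ g z = 0 := by
    by_contra h'
    exact h (support_fderiv_subset ℝ h')
  exact hz (by simp [dbar, this])

lemma integrableOn_polar_of_continuous {f : ℝ × ℝ → ℂ} (hf : Continuous f) {R : ℝ}
    (hR : ∀ p : ℝ × ℝ, R < p.1 → f p = 0) :
    IntegrableOn f (Set.Ioi 0 ×ˢ Set.Ioo (-Real.pi) Real.pi) := by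
  have h : IntegrableOn f (Set.Icc 0 R ×ˢ Set.Icc (-Real.pi) Real.pi) :=
    hf.continuousOn.integrableOn_compact (isCompact_Icc.prod isCompact_Icc)
  refine h.of_forall_sdiff_eq_zero (measurableSet_Ioi.prod measurableSet_Ioo) fun p hp => hR p ?_
  by_contra! hle
  exact hp.2 ⟨⟨le_of_lt hp.1.1, hle⟩, Set.Ioo_subset_Icc_self hp.1.2⟩

/-- The Cauchy–Pompeiu formula at the origin for compactly supported functions. -/
lemma integral_dbar_div {g : ℂ → ℂ} (hg : ContDiff ℝ 1 g) (hc : HasCompactSupport g) :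
    ∫ z, dbar g z / z = -Real.pi * g 0 := by
  have hfd : Continuous (fderiv ℝ g) := hg.continuous_fderiv one_ne_zero
  obtain ⟨R, hR⟩ := (show Bornology.IsBounded (tsupport g) from
    hc.isCompact.isBounded).subset_closedBall 0
  have hR0 : ∀ z : ℂ, R < ‖z‖ → z ∉ tsupport g := fun z hz h => by
    have := hR h
    rw [mem_closedBall_zero_iff] at this
    linarith
  have hRg : ∀ z : ℂ, R < ‖z‖ → g z = 0 := fun z hz => image_eq_zero_of_notMem_tsupport (hR0 z hz)
  have hRd : ∀ z : ℂ, R < ‖z‖ → fderiv ℝ g z = 0 := fun z hz => by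
    by_contra h
    exact hR0 z hz (support_fderiv_subset ℝ h)
  set e : ℝ → ℂ := fun t => Complex.exp (t * Complex.I) with he
  have hen : ∀ t, ‖e t‖ = 1 := fun t => Complex.norm_exp_ofReal_mul_I t
  have hec : Continuous e := by fun_prop
  have hnorm : ∀ r t : ℝ, ‖(r : ℂ) * e t‖ = |r| := fun r t => by
    rw [norm_mul, hen, mul_one, Complex.norm_real, Real.norm_eq_abs]
  set Gr : ℝ × ℝ → ℂ := fun p => fderiv ℝ g (p.1 * e p.2) (e p.2) with hGr
  set Gt : ℝ × ℝ → ℂ := fun p => fderiv ℝ g (p.1 * e p.2) (e p.2 * Complex.I) with hGt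
  have hGrc : Continuous Gr := by fun_prop
  have hGtc : Continuous Gt := by fun_prop
  have hGr0 : ∀ p : ℝ × ℝ, R < p.1 → Gr p = 0 := fun p hp => by
    simp only [hGr]
    rw [hRd _ (by rw [hnorm]; exact hp.trans_le (le_abs_self _))]; rfl
  have hGt0 : ∀ p : ℝ × ℝ, R < p.1 → Gt p = 0 := fun p hp => by
    simp only [hGt]
    rw [hRd _ (by rw [hnorm]; exact hp.trans_le (le_abs_self _))]; rfl
  have hGri := integrableOn_polar_of_continuous hGrc hGr0
  have hGti := integrableOn_polar_of_continuous hGtc hGt0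
  have hrad : ∫ p in Set.Ioi 0 ×ˢ Set.Ioo (-Real.pi) Real.pi, Gr p = -(2 * Real.pi) * g 0 := by
    have hswap : ∫ p in Set.Ioi 0 ×ˢ Set.Ioo (-Real.pi) Real.pi, Gr p =
        ∫ t in Set.Ioo (-Real.pi) Real.pi, ∫ r in Set.Ioi 0, Gr (r, t) := by
      rw [Measure.volume_eq_prod, setIntegral_prod Gr hGri]
      refine integral_integral_swap (f := fun r t => Gr (r, t)) ?_
      rw [Measure.prod_restrict]
      exact hGri
    have hinner : ∀ t, ∫ r in Set.Ioi (0 : ℝ), Gr (r, t) = -g 0 := by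
      intro t
      have hderiv : ∀ r ∈ Set.Ici (0 : ℝ), HasDerivAt (fun r : ℝ => g (r * e t)) (Gr (r, t)) r := by
        intro r _
        have h1 : HasDerivAt (fun r : ℝ => (r : ℂ) * e t) (e t) r := by
          simpa using (Complex.ofRealCLM.hasDerivAt (x := r)).mul_const (e t)
        exact ((hg.differentiable one_ne_zero).differentiableAt.hasFDerivAt).comp_hasDerivAt r h1
      have hint : IntegrableOn (fun r => Gr (r, t)) (Set.Ioi (0 : ℝ)) := by
        have h : IntegrableOn (fun r => Gr (r, t)) (Set.Icc 0 R) :=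
          (hGrc.comp (by fun_prop : Continuous fun r : ℝ => (r, t))).continuousOn.integrableOn_compact
            isCompact_Icc
        refine h.of_forall_sdiff_eq_zero measurableSet_Ioi fun r hr => hGr0 _ ?_
        by_contra! hle
        exact hr.2 ⟨le_of_lt hr.1, hle⟩
      rw [integral_Ioi_of_hasDerivAt_of_tendsto' (m := 0) hderiv hint]
      · simp
      · refine tendsto_const_nhds.congr' ?_
        filter_upwards [Filter.eventually_gt_atTop R] with r hr
        exact (hRg _ (by rw [hnorm]; exact hr.trans_le (le_abs_self _))).symm
    rw [hswap]
    simp only [hinner]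
    rw [setIntegral_const, Measure.real, Real.volume_Ioo, ENNReal.toReal_ofReal
      (by linarith [Real.pi_pos]), Complex.real_smul]
    push_cast
    ring
  -- `Gt` is `r⁻¹` times the derivative in `t` of `g (r * e t)`, so it integrates to zero over a
  -- period.
  have hang : ∫ p in Set.Ioi 0 ×ˢ Set.Ioo (-Real.pi) Real.pi, Gt p = 0 := by
    rw [Measure.volume_eq_prod, setIntegral_prod Gt hGti]
    refine setIntegral_eq_zero_of_forall_eq_zero fun r hr => ?_
    have hr0 : (r : ℂ) ≠ 0 := Complex.ofReal_ne_zero.2 (ne_of_gt hr)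
    have hderiv : ∀ t : ℝ, HasDerivAt (fun t : ℝ => (r : ℂ)⁻¹ * g (r * e t)) (Gt (r, t)) t := by
      intro t
      have h1 : HasDerivAt (fun t : ℝ => (r : ℂ) * e t) ((r : ℝ) • (e t * Complex.I)) t := by
        have h2 : HasDerivAt (fun t : ℝ => (t : ℂ) * Complex.I) Complex.I t := by
          simpa using (Complex.ofRealCLM.hasDerivAt (x := t)).mul_const Complex.I
        simpa [he, Complex.real_smul] using h2.cexp.const_mul (r : ℂ)
      have h3 := (((hg.differentiable one_ne_zero).differentiableAt
        (x := (r : ℂ) * e t)).hasFDerivAt.comp_hasDerivAt t h1).const_mul (r : ℂ)⁻¹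
      rw [map_smul, Complex.real_smul, inv_mul_cancel_left₀ hr0] at h3
      exact h3
    have hcont : Continuous fun t => Gt (r, t) :=
      hGtc.comp (by fun_prop : Continuous fun t : ℝ => (r, t))
    rw [← integral_Ioc_eq_integral_Ioo, ← intervalIntegral.integral_of_le
      (by linarith [Real.pi_pos]), intervalIntegral.integral_eq_sub_of_hasDerivAt
      (fun t _ => hderiv t) (hcont.intervalIntegrable _ _)]
    have : e (-Real.pi) = e Real.pi := by
      simp [he, Complex.exp_neg]
    simp [this]
  rw [← Complex.integral_comp_polarCoord_symm, polarCoord_target]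
  have hcongr : ∀ p ∈ Set.Ioi (0 : ℝ) ×ˢ Set.Ioo (-Real.pi) Real.pi,
      p.1 • (dbar g (Complex.polarCoord.symm p) / Complex.polarCoord.symm p) =
        (1 / 2) * (Gr p + Complex.I * Gt p) := by
    intro p hp
    have hp0 : (p.1 : ℂ) ≠ 0 := Complex.ofReal_ne_zero.2 (ne_of_gt hp.1)
    have hpe : Complex.polarCoord.symm p = p.1 * e p.2 := by
      simp only [he]
      rw [Complex.polarCoord_symm_apply, Complex.exp_mul_I]
      push_cast
      rfl
    have he1 : e p.2 * (starRingEnd ℂ) (e p.2) = 1 := by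
      rw [Complex.mul_conj, Complex.normSq_eq_norm_sq, hen]; simp
    rw [hpe, Complex.real_smul, hGr, hGt]
    simp only
    rw [← dbar_div_eq g _ _ he1]
    field_simp
  rw [setIntegral_congr_fun (measurableSet_Ioi.prod measurableSet_Ioo) hcongr,
    integral_const_mul, integral_add hGri (hGti.const_mul _), integral_const_mul, hrad, hang]
  ring

lemma dbar_comp_add (g : ℂ → ℂ) (a z : ℂ) : dbar (fun w => g (w + a)) z = dbar g (z + a) := by
  simp [dbar, fderiv_comp_add_right]

/-- The Cauchy–Pompeiu formula for compactly supported functions. -/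
theorem integral_dbar_div_sub {g : ℂ → ℂ} (hg : ContDiff ℝ 1 g) (hc : HasCompactSupport g)
    (a : ℂ) : ∫ z, dbar g z / (z - a) = -Real.pi * g a := by
  have h := integral_dbar_div (g := fun w => g (w + a)) (hg.comp (contDiff_id.add contDiff_const))
    (hc.comp_homeomorph (Homeomorph.addRight a))
  rw [← integral_add_right_eq_self _ a]
  simpa [dbar_comp_add] using h

/-! ### Runge approximation of the indicator -/

/-- Two disjoint compact sets whose union has connected complement are separated by polynomials. -/
theorem exists_polynomial_near_indicator {A B : Set ℂ} (hA : IsCompact A) (hB : IsCompact B)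
    (hAB : Disjoint A B) (hconn : IsPreconnected (A ∪ B)ᶜ) {ε : ℝ} (hε : 0 < ε) :
    ∃ h : Polynomial ℂ, (∀ z ∈ A, ‖h.eval z - 1‖ ≤ ε) ∧ ∀ z ∈ B, ‖h.eval z‖ ≤ ε := by
  set E := A ∪ B with hE
  have hEc : IsCompact E := hA.union hB
  have : CompactSpace E := isCompact_iff_compactSpace.1 hEc
  -- a smooth cutoff function
  obtain ⟨r, hr⟩ := hA.isBounded.subset_ball 0
  -- Vanishing outside a ball gives compact support; local constancy near `A` and `B` keeps the
  -- support of `dbar g` off `E`.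
  obtain ⟨χ, hχB, hχA, -⟩ := exists_contMDiffMap_zero_one_nhds_of_isClosed (n := 1)
    (modelWithCornersSelf ℝ ℂ) (hB.isClosed.union Metric.isOpen_ball.isClosed_compl) hA.isClosed
    (Disjoint.union_left hAB.symm (Set.disjoint_left.2 fun z hz hzA => hz (hr hzA)))
  rw [Filter.eventually_iff, mem_nhdsSet_iff_forall] at hχA hχB
  have hχA1 : ∀ z ∈ A, χ z = 1 := fun z hz =>
    (show ∀ᶠ w in 𝓝 z, χ w = 1 from hχA z hz).self_of_nhds
  have hχB0 : ∀ z ∈ B ∪ (Metric.ball 0 r)ᶜ, χ z = 0 := fun z hz =>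
    (show ∀ᶠ w in 𝓝 z, χ w = 0 from hχB z hz).self_of_nhds
  set g : ℂ → ℂ := fun z => (χ z : ℂ) with hg
  have hgd : ContDiff ℝ 1 g := Complex.ofRealCLM.contDiff.comp χ.contMDiff.contDiff
  have hgc : HasCompactSupport g := by
    refine HasCompactSupport.intro (isCompact_closedBall (0 : ℂ) r) fun z hz => ?_
    have : χ z = 0 := hχB0 z (Or.inr fun h => hz (Metric.ball_subset_closedBall h))
    simp [hg, this]
  have hd0 : ∀ z ∈ E, z ∉ tsupport (dbar g) := by
    have hconst : ∀ (c : ℝ) z, (∀ᶠ w in 𝓝 z, χ w = c) → z ∉ tsupport (dbar g) := by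
      intro c z hz
      rw [notMem_tsupport_iff_eventuallyEq]
      filter_upwards [hz.eventually_nhds] with w hw
      have : fderiv ℝ g w = 0 := by
        have h1 : g =ᶠ[𝓝 w] fun _ => (c : ℂ) := hw.mono fun x hx => by simp [hg, hx]
        rw [h1.fderiv_eq]
        exact fderiv_const_apply _
      simp [dbar, this]
    rintro z (hz | hz)
    · exact hconst 1 z (hχA z hz)
    · exact hconst 0 z (hχB z (Or.inl hz))
  -- the closed algebra generated by the polynomials
  set S : Subalgebra ℂ C(E, ℂ) := (polynomialFunctions E).topologicalClosure with hS
  have hScl : IsClosed (S : Set C(E, ℂ)) := (polynomialFunctions E).isClosed_topologicalClosure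
  have : CompleteSpace S := hScl.completeSpace_coe
  let x : S := ⟨Polynomial.X.toContinuousMapOn E,
    (polynomialFunctions E).le_topologicalClosure ⟨Polynomial.X, by simp, rfl⟩⟩
  have hx : ∀ z : E, (x : C(E, ℂ)) z = z := fun z => by simp [x]
  have hspecA : spectrum ℂ (x : C(E, ℂ)) = E := by
    rw [ContinuousMap.spectrum_eq_range]
    ext z
    constructor
    · rintro ⟨w, rfl⟩; rw [hx]; exact w.2
    · intro hz; exact ⟨⟨z, hz⟩, hx _⟩
  -- Passing to a closed subalgebra can only fill holes of the spectrum, and the connected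
  -- complement leaves none. So `1 / (ζ - x)` is a uniform limit of polynomials for every `ζ ∉ E`.
  have hspec : spectrum ℂ x = E := by
    refine (Subalgebra.spectrum_eq_of_isPreconnected_compl S x ?_).trans hspecA
    rw [hspecA]
    exact hconn
  have hres : ∀ ζ ∉ E, ζ ∈ resolventSet ℂ x := fun ζ hζ => by
    rw [← hspec] at hζ
    exact not_not.1 hζ
  -- Up to the factor `-π`, the integral of `F` is the Cauchy–Pompeiu formula for `g` on `E`,
  -- carried out inside `S`; hence `g` restricted to `E` lies in `S`.
  set F : ℂ → S := fun ζ => dbar g ζ • resolvent x ζ with hF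
  have hFc : Continuous F := by
    rw [continuous_iff_continuousAt]
    intro ζ
    by_cases hζ : ζ ∈ tsupport (dbar g)
    · exact (continuous_dbar hgd).continuousAt.smul
        (spectrum.hasDerivAt_resolvent_const_left
          (hres ζ fun h => hd0 ζ h hζ)).continuousAt
    · refine (continuousAt_const (y := (0 : S))).congr ?_
      filter_upwards [notMem_tsupport_iff_eventuallyEq.1 hζ] with w hw
      simp [hF, hw]
  have hFi : Integrable F := by
    refine hFc.integrable_of_hasCompactSupport ?_
    refine HasCompactSupport.intro hgc.isCompact fun z hz => ?_
    have : dbar g z = 0 :=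
      image_eq_zero_of_notMem_tsupport fun h => hz (tsupport_dbar_subset g h)
    simp [hF, this]
  have heval : ∀ z : E, ((∫ ζ, F ζ : S) : C(E, ℂ)) z = -Real.pi * g z := by
    intro z
    let L : S →L[ℂ] ℂ := (ContinuousMap.evalCLM ℂ z).comp S.toSubmodule.subtypeL
    have hL : ∀ f : S, L f = (f : C(E, ℂ)) z := fun f => rfl
    rw [← hL, ← L.integral_comp_comm hFi, ← integral_dbar_div_sub hgd hgc]
    congr 1
    ext ζ
    by_cases hζ : ζ ∈ E
    · have : dbar g ζ = 0 := image_eq_zero_of_notMem_tsupport (hd0 ζ hζ)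
      simp [hF, this]
    · have h1 : (algebraMap ℂ S ζ - x) * resolvent x ζ = 1 := Ring.mul_inverse_cancel _ (hres ζ hζ)
      have h2 := congrArg (fun f : S => (f : C(E, ℂ)) z) h1
      have h3 : (ζ - z) * ((resolvent x ζ : S) : C(E, ℂ)) z = 1 := by
        simpa [hx] using h2
      have h4 : ζ - (z : ℂ) ≠ 0 := left_ne_zero_of_mul_eq_one h3
      rw [hL, div_eq_mul_inv, ← eq_inv_of_mul_eq_one_right h3]
      rfl
  have hmem : ((-(Real.pi : ℂ)⁻¹ • ∫ ζ, F ζ : S) : C(E, ℂ)) ∈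
      closure ((polynomialFunctions E : Subalgebra ℂ C(E, ℂ)) : Set C(E, ℂ)) :=
    (-(Real.pi : ℂ)⁻¹ • ∫ ζ, F ζ : S).2
  obtain ⟨_, ⟨h, -, rfl⟩, hdist⟩ := Metric.mem_closure_iff.1 hmem ε hε
  have hfin : ∀ z ∈ E, ‖h.eval z - g z‖ ≤ ε := by
    intro z hz
    have h1 := (ContinuousMap.dist_lt_iff hε).1 hdist ⟨z, hz⟩
    have hpi : (Real.pi : ℂ) ≠ 0 := Complex.ofReal_ne_zero.2 Real.pi_ne_zero
    have h2 : ((-(Real.pi : ℂ)⁻¹ • ∫ ζ, F ζ : S) : C(E, ℂ)) ⟨z, hz⟩ = g z := by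
      have := heval ⟨z, hz⟩
      change -(Real.pi : ℂ)⁻¹ * ((∫ ζ, F ζ : S) : C(E, ℂ)) ⟨z, hz⟩ = g z
      rw [this]
      field_simp
    rw [h2, dist_comm, dist_eq_norm] at h1
    exact h1.le
  refine ⟨h, fun z hz => ?_, fun z hz => ?_⟩
  · have h1 : χ z = 1 := hχA1 z hz
    simpa [hg, h1] using hfin z (Or.inl hz)
  · have h1 : χ z = 0 := hχB0 z (Or.inl hz)
    simpa [hg, h1] using hfin z (Or.inr hz)

/-! ### Sharpening by a majority vote -/

/-- The probability that a binomial variable with `2 n + 1` trials exceeds `n`, as a polynomial in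
the success probability. -/
noncomputable def stepPoly (n : ℕ) : Polynomial ℂ :=
  ∑ j ∈ Finset.Ico (n + 1) (2 * n + 1 + 1),
    Polynomial.X ^ j * (1 - Polynomial.X) ^ (2 * n + 1 - j) * ((2 * n + 1).choose j : Polynomial ℂ)

lemma natDegree_stepPoly_le (n : ℕ) : (stepPoly n).natDegree ≤ 2 * n + 1 := by
  refine Polynomial.natDegree_sum_le_of_forall_le _ _ fun j hj => ?_
  have hj' := Finset.mem_Ico.1 hj
  have h1 : (1 - Polynomial.X : Polynomial ℂ).natDegree ≤ 1 := by compute_degree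
  have h2 := Polynomial.natDegree_pow_le_of_le (2 * n + 1 - j) h1
  have h3 : (Polynomial.X ^ j : Polynomial ℂ).natDegree ≤ j := by simp
  have h4 := Polynomial.natDegree_mul_le_of_le (Polynomial.natDegree_mul_le_of_le h3 h2)
    (Polynomial.natDegree_natCast ((2 * n + 1).choose j) (R := ℂ)).le
  omega

lemma eval_stepPoly (n : ℕ) (x : ℂ) : (stepPoly n).eval x =
    ∑ j ∈ Finset.Ico (n + 1) (2 * n + 1 + 1),
      x ^ j * (1 - x) ^ (2 * n + 1 - j) * ((2 * n + 1).choose j : ℂ) := by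
  simp [stepPoly, Polynomial.eval_finsetSum]

lemma one_sub_eval_stepPoly (n : ℕ) (x : ℂ) : 1 - (stepPoly n).eval x =
    ∑ j ∈ Finset.range (n + 1),
      x ^ j * (1 - x) ^ (2 * n + 1 - j) * ((2 * n + 1).choose j : ℂ) := by
  have h := add_pow x (1 - x) (2 * n + 1)
  rw [add_sub_cancel, one_pow, ← Finset.sum_range_add_sum_Ico _
    (show n + 1 ≤ 2 * n + 1 + 1 by omega)] at h
  rw [eval_stepPoly]
  exact sub_eq_of_eq_add h

lemma norm_sum_choose_mul_le {n : ℕ} {δ : ℝ} {t : Finset ℕ} (ht : t ⊆ Finset.range (2 * n + 1 + 1))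
    {c : ℕ → ℂ} (hc : ∀ j ∈ t, ‖c j‖ ≤ δ ^ n * 2 ^ n) (hδ : 0 ≤ δ) :
    ‖∑ j ∈ t, c j * ((2 * n + 1).choose j : ℂ)‖ ≤ 2 * (8 * δ) ^ n := by
  calc ‖∑ j ∈ t, c j * ((2 * n + 1).choose j : ℂ)‖
      ≤ ∑ j ∈ t, δ ^ n * 2 ^ n * ((2 * n + 1).choose j : ℝ) := by
        refine norm_sum_le_of_le _ fun j hj => ?_
        rw [norm_mul, Complex.norm_natCast]
        gcongr
        exact hc j hj
    _ ≤ ∑ j ∈ Finset.range (2 * n + 1 + 1), δ ^ n * 2 ^ n * ((2 * n + 1).choose j : ℝ) :=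
        Finset.sum_le_sum_of_subset_of_nonneg ht fun j _ _ => by positivity
    _ = δ ^ n * 2 ^ n * 2 ^ (2 * n + 1) := by
        rw [← Finset.mul_sum, ← Nat.cast_sum, Nat.sum_range_choose]
        push_cast
        rfl
    _ = 2 * (8 * δ) ^ n := by
        rw [pow_succ, pow_mul, show (8 : ℝ) * δ = δ * 2 * 2 ^ 2 by ring, mul_pow, mul_pow]
        ring

/-- With `2 * n + 1` trials, every term of the relevant tail has at least `n` factors of size at
most `δ` and at most `n` of size at most 2. -/
lemma norm_pow_mul_pow_le {a b : ℂ} {δ : ℝ} (hδ : δ ≤ 1) (ha : ‖a‖ ≤ δ) (hb : ‖b‖ ≤ 2)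
    {n j k : ℕ} (hj : n ≤ j) (hk : k ≤ n) : ‖a ^ j * b ^ k‖ ≤ δ ^ n * 2 ^ n := by
  have h0 : 0 ≤ δ := (norm_nonneg a).trans ha
  rw [norm_mul, norm_pow, norm_pow]
  gcongr
  · exact (pow_le_pow_left₀ (norm_nonneg a) ha j).trans (pow_le_pow_of_le_one h0 hδ hj)
  · exact (pow_le_pow_left₀ (norm_nonneg b) hb k).trans (pow_le_pow_right₀ one_le_two hk)

lemma norm_eval_stepPoly_le {n : ℕ} {x : ℂ} {δ : ℝ} (hδ : δ ≤ 1) (hx : ‖x‖ ≤ δ) :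
    ‖(stepPoly n).eval x‖ ≤ 2 * (8 * δ) ^ n := by
  rw [eval_stepPoly]
  refine norm_sum_choose_mul_le (fun j hj => ?_) (fun j hj => ?_) ((norm_nonneg x).trans hx)
  · exact Finset.mem_range.2 (Finset.mem_Ico.1 hj).2
  · have hj' := Finset.mem_Ico.1 hj
    refine norm_pow_mul_pow_le hδ hx ?_ (by omega) (by omega)
    have := norm_sub_le (1 : ℂ) x
    rw [norm_one] at this
    linarith

lemma norm_one_sub_eval_stepPoly_le {n : ℕ} {x : ℂ} {δ : ℝ} (hδ : δ ≤ 1) (hx : ‖x - 1‖ ≤ δ) :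
    ‖1 - (stepPoly n).eval x‖ ≤ 2 * (8 * δ) ^ n := by
  rw [one_sub_eval_stepPoly]
  refine norm_sum_choose_mul_le (fun j hj => ?_) (fun j hj => ?_) ((norm_nonneg _).trans hx)
  · have := Finset.mem_range.1 hj
    exact Finset.mem_range.2 (by omega)
  · have hj' := Finset.mem_range.1 hj
    rw [mul_comm]
    refine norm_pow_mul_pow_le hδ (by rwa [norm_sub_rev]) ?_ (by omega) (by omega)
    have := norm_add_le (x - 1) 1
    rw [norm_one, sub_add_cancel] at this
    linarith

/-! ### Gluing approximants -/

lemma enorm_le_supNorm {E : Set ℂ} (f : ℂ → ℂ) {z : ℂ} (hz : z ∈ E) : ‖f z‖ₑ ≤ supNorm E f :=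
  le_iSup₂ (f := fun (z : ℂ) (_ : z ∈ E) => ‖f z‖ₑ) z hz

lemma supNorm_union_le (A B : Set ℂ) (f : ℂ → ℂ) :
    supNorm (A ∪ B) f ≤ supNorm A f + supNorm B f := by
  refine iSup₂_le fun z hz => ?_
  rcases hz with hz | hz
  · exact (enorm_le_supNorm f hz).trans le_self_add
  · exact (enorm_le_supNorm f hz).trans le_add_self

lemma supNorm_ne_top {E : Set ℂ} (hE : IsCompact E) {f : ℂ → ℂ} (hf : ContinuousOn f E) :
    supNorm E f ≠ ⊤ := by
  obtain ⟨C, hC⟩ := hE.exists_bound_of_continuousOn hf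
  refine ne_top_of_le_ne_top (ENNReal.ofReal_ne_top (r := C)) (iSup₂_le fun z hz => ?_)
  rw [← ofReal_norm]
  exact ENNReal.ofReal_le_ofReal (hC z hz)

lemma polyDist_le {E : Set ℂ} (f : ℂ → ℂ) {n : ℕ} {p : Polynomial ℂ} (hp : p.natDegree ≤ n) :
    polyDist E f n ≤ supNorm E (fun z => f z - p.eval z) :=
  iInf₂_le p (Polynomial.mem_degreeLE.2 (Polynomial.natDegree_le_iff_degree_le.1 hp))

lemma polyDist_le_supNorm (E : Set ℂ) (f : ℂ → ℂ) (n : ℕ) : polyDist E f n ≤ supNorm E f := by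
  simpa using polyDist_le (E := E) f (n := n) (p := 0) (by simp)

lemma polyDist_antitone (E : Set ℂ) (f : ℂ → ℂ) : Antitone (polyDist E f) := by
  intro m n hmn
  refine le_iInf₂ fun p hp => polyDist_le f ?_
  exact (Polynomial.natDegree_le_iff_degree_le.2 (Polynomial.mem_degreeLE.1 hp)).trans hmn

/-- The pointwise error at `z ∈ A` of blending an approximant `p` on `A` with an approximant `q` on
`B`, where the weight `e` of `q` at `z` is small enough to absorb the growth of `q` off `B`. -/
lemma enorm_sub_le_of_blend {A B : Set ℂ} {R : ℝ} (hR : 1 ≤ R) {n : ℕ} {f : ℂ → ℂ}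
    {p q : Polynomial ℂ} {z w e : ℂ} (hz : z ∈ A) (hw : w ∈ B)
    (hq : ‖q.eval z‖ ≤ R ^ n * ‖q.eval w‖) (he : ‖e‖ ≤ 2 * (8 * (1 / (16 * R))) ^ n) {g : ℂ}
    (hg : g = (f z - p.eval z) + (p.eval z - q.eval z) * e) :
    ‖g‖ₑ ≤ 3 * (supNorm A (fun z => f z - p.eval z) + supNorm B (fun z => f z - q.eval z)) +
      2 * 2⁻¹ ^ n * (supNorm A f + supNorm B f) := by
  have hR0 : 0 < R := one_pos.trans_le hR
  have h16 : 8 * (1 / (16 * R)) = 2⁻¹ * R⁻¹ := by field_simp; norm_num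
  rw [h16, mul_pow] at he
  have hRn : (R⁻¹) ^ n ≤ 1 := pow_le_one₀ (by positivity) (inv_le_one_of_one_le₀ hR)
  have hreal : ‖g‖ ≤ ‖f z - p.eval z‖ + 2 * 2⁻¹ ^ n *
      (‖f z - p.eval z‖ + ‖f z‖ + (‖f w - q.eval w‖ + ‖f w‖)) := by
    have h1 : ‖p.eval z‖ ≤ ‖f z - p.eval z‖ + ‖f z‖ := by
      have := norm_sub_le (f z) (f z - p.eval z)
      rw [sub_sub_cancel] at this
      linarith
    have h2 : ‖q.eval w‖ ≤ ‖f w - q.eval w‖ + ‖f w‖ := by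
      have := norm_sub_le (f w) (f w - q.eval w)
      rw [sub_sub_cancel] at this
      linarith
    have h3 : ‖p.eval z‖ * ‖e‖ ≤ 2 * 2⁻¹ ^ n * ‖p.eval z‖ := by
      rw [mul_comm]
      gcongr
      refine he.trans ?_
      gcongr
      exact mul_le_of_le_one_right (by positivity) hRn
    have h4 : ‖q.eval z‖ * ‖e‖ ≤ 2 * 2⁻¹ ^ n * ‖q.eval w‖ := by
      calc _ ≤ (R ^ n * ‖q.eval w‖) * (2 * (2⁻¹ ^ n * R⁻¹ ^ n)) := by gcongr
        _ = 2 * 2⁻¹ ^ n * ‖q.eval w‖ * (R ^ n * R⁻¹ ^ n) := by ring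
        _ = _ := by rw [← mul_pow, mul_inv_cancel₀ hR0.ne', one_pow, mul_one]
    calc ‖g‖ ≤ ‖f z - p.eval z‖ + ‖(p.eval z - q.eval z) * e‖ := by rw [hg]; exact norm_add_le _ _
      _ ≤ ‖f z - p.eval z‖ + (‖p.eval z‖ + ‖q.eval z‖) * ‖e‖ := by
          rw [norm_mul]; gcongr; exact norm_sub_le _ _
      _ ≤ ‖f z - p.eval z‖ + 2 * 2⁻¹ ^ n * (‖p.eval z‖ + ‖q.eval w‖) := by linarith
      _ ≤ _ := by gcongr
  have hen : ‖g‖ₑ ≤ ‖f z - p.eval z‖ₑ + 2 * 2⁻¹ ^ n *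
      (‖f z - p.eval z‖ₑ + ‖f z‖ₑ + (‖f w - q.eval w‖ₑ + ‖f w‖ₑ)) := by
    have h := ENNReal.ofReal_le_ofReal hreal
    rw [ENNReal.ofReal_add (by positivity) (by positivity), ENNReal.ofReal_mul (by positivity),
      ENNReal.ofReal_mul (by positivity), ENNReal.ofReal_add (by positivity) (by positivity),
      ENNReal.ofReal_add (by positivity) (by positivity),
      ENNReal.ofReal_add (by positivity) (by positivity), ENNReal.ofReal_pow (by positivity),
      ENNReal.ofReal_inv_of_pos two_pos] at h
    simpa only [ofReal_norm, ENNReal.ofReal_ofNat] using h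
  have h1 : ‖f z - p.eval z‖ₑ ≤ supNorm A (fun z => f z - p.eval z) :=
    enorm_le_supNorm (fun z => f z - p.eval z) hz
  have h2 : ‖f w - q.eval w‖ₑ ≤ supNorm B (fun z => f z - q.eval z) :=
    enorm_le_supNorm (fun z => f z - q.eval z) hw
  have h3 := enorm_le_supNorm f hz
  have h4 := enorm_le_supNorm f hw
  set a := supNorm A (fun z => f z - p.eval z)
  set b := supNorm B (fun z => f z - q.eval z)
  have h5 : (2 : ℝ≥0∞)⁻¹ ^ n ≤ 1 := pow_le_one₀ (by simp) (by simp)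
  calc ‖g‖ₑ ≤ a + 2 * 2⁻¹ ^ n * (a + supNorm A f + (b + supNorm B f)) := by
        refine hen.trans ?_; gcongr
    _ = a + 2 * 2⁻¹ ^ n * (a + b) + 2 * 2⁻¹ ^ n * (supNorm A f + supNorm B f) := by ring
    _ ≤ (a + b) + 2 * 1 * (a + b) + 2 * 2⁻¹ ^ n * (supNorm A f + supNorm B f) := by
        gcongr; exact le_self_add
    _ = _ := by ring

/-- Polynomial approximations on two separated sets can be glued at the cost of a constant factor in
the degree and a geometrically small error. -/
theorem exists_polyDist_union_le {A B : Set ℂ} (hA : IsCompact A) (hB : IsCompact B)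
    (hAB : Disjoint A B) (hconn : IsPreconnected (A ∪ B)ᶜ)
    (hAcap : 0 < logCapacity A) (hBcap : 0 < logCapacity B) :
    ∃ M : ℕ, 1 ≤ M ∧ ∀ (f : ℂ → ℂ) (n : ℕ), 1 ≤ n →
      polyDist (A ∪ B) f (M * n) ≤ 3 * (polyDist A f n + polyDist B f n) +
        2 * 2⁻¹ ^ n * (supNorm A f + supNorm B f) := by
  obtain ⟨R₁, hR₁, hAw⟩ := exists_norm_eval_le_pow_mul hA.isBounded hB hBcap
  obtain ⟨R₂, hR₂, hBw⟩ := exists_norm_eval_le_pow_mul hB.isBounded hA hAcap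
  set R := max R₁ R₂
  have hR : 1 ≤ R := hR₁.trans (le_max_left _ _)
  have hR0 : 0 < R := one_pos.trans_le hR
  -- With `δ = 1 / (16 * R)`, the step bound `2 * (8 * δ) ^ n` is `2 * (2 * R)⁻¹ ^ n`: it cancels
  -- the growth `R ^ n` and still leaves `2⁻¹ ^ n`.
  have hδ1 : 1 / (16 * R) ≤ 1 := by
    rw [div_le_one (by positivity)]; linarith
  obtain ⟨h, hhA, hhB⟩ := exists_polynomial_near_indicator hA hB hAB hconn
    (show 0 < 1 / (16 * R) by positivity)
  refine ⟨1 + 3 * h.natDegree, by omega, fun f n hn => ?_⟩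
  have key : ∀ p q : Polynomial ℂ, p ∈ Polynomial.degreeLE ℂ n → q ∈ Polynomial.degreeLE ℂ n →
      polyDist (A ∪ B) f ((1 + 3 * h.natDegree) * n) ≤
        3 * (supNorm A (fun z => f z - p.eval z) + supNorm B (fun z => f z - q.eval z)) +
          2 * 2⁻¹ ^ n * (supNorm A f + supNorm B f) := by
    intro p q hp hq
    have hp' := Polynomial.natDegree_le_iff_degree_le.2 (Polynomial.mem_degreeLE.1 hp)
    have hq' := Polynomial.natDegree_le_iff_degree_le.2 (Polynomial.mem_degreeLE.1 hq)
    set H := (stepPoly n).comp h with hH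
    have hHd : H.natDegree ≤ (2 * n + 1) * h.natDegree :=
      Polynomial.natDegree_comp_le.trans (Nat.mul_le_mul_right _ (natDegree_stepPoly_le n))
    have hdeg : (q + (p - q) * H).natDegree ≤ (1 + 3 * h.natDegree) * n := by
      have h1 : (p - q).natDegree ≤ n :=
      (Polynomial.natDegree_sub_le_of_le hp' hq').trans_eq (max_self n)
      have h2 := Polynomial.natDegree_mul_le_of_le h1 hHd
      refine (Polynomial.natDegree_add_le_of_degree_le (hq'.trans le_self_add) h2).trans ?_
      have : h.natDegree ≤ n * h.natDegree := Nat.le_mul_of_pos_left _ hn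
      nlinarith
    refine (polyDist_le f hdeg).trans (iSup₂_le fun z hz => ?_)
    rcases hz with hz | hz
    · obtain ⟨w, hw, hle⟩ := hAw n q hq' z hz
      refine enorm_sub_le_of_blend hR (e := 1 - H.eval z) hz hw (hle.trans ?_) ?_ ?_
      · gcongr
        exact le_max_left _ _
      · rw [hH, Polynomial.eval_comp]
        exact norm_one_sub_eval_stepPoly_le hδ1 (hhA z hz)
      · simp only [Polynomial.eval_add, Polynomial.eval_mul, Polynomial.eval_sub]
        ring
    · obtain ⟨w, hw, hle⟩ := hBw n p hp' z hz
      rw [add_comm (supNorm A _), add_comm (supNorm A f)]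
      refine enorm_sub_le_of_blend hR (e := H.eval z) hz hw (hle.trans ?_) ?_ ?_
      · gcongr
        exact le_max_right _ _
      · rw [hH, Polynomial.eval_comp]
        exact norm_eval_stepPoly_le hδ1 (hhB z hz)
      · simp only [Polynomial.eval_add, Polynomial.eval_mul, Polynomial.eval_sub]
        ring
  simp only [polyDist, ENNReal.iInf_add, ENNReal.add_iInf,
    ENNReal.mul_iInf_of_ne (a := 3) (by simp) (by simp)]
  exact le_iInf₂ fun q hq => le_iInf₂ fun p hp => key p q hp hq

/-! ### From gluing to the Jackson norms -/

lemma rpow_mul_two_inv_pow_le {ℓ : ℝ} (hℓ : 1 ≤ ℓ) {n : ℕ} (hn : 1 ≤ n) :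
    (n : ℝ≥0∞) ^ ℓ * 2⁻¹ ^ n ≤ ENNReal.ofReal (2 * ℓ) ^ ℓ := by
  have hℓ0 : 0 < ℓ := one_pos.trans_le hℓ
  have hn0 : (0 : ℝ) < n := by exact_mod_cast hn
  have hreal : (n : ℝ) ^ ℓ * 2⁻¹ ^ n ≤ (2 * ℓ) ^ ℓ := by
    rw [inv_pow, ← div_eq_mul_inv, div_le_iff₀ (by positivity),
      ← Real.log_le_log_iff (by positivity) (by positivity), Real.log_mul (by positivity)
      (by positivity), Real.log_rpow hn0, Real.log_rpow (by positivity), Real.log_pow]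
    -- Multiplied by `ℓ`, this gives `ℓ * log (n / (2 * ℓ)) ≤ n / 2 - ℓ`, which is below `n * log
    -- 2`.
    have h1 := Real.log_le_sub_one_of_pos (show 0 < n / (2 * ℓ) by positivity)
    rw [Real.log_div hn0.ne' (by positivity)] at h1
    have h2 : ℓ * (n / (2 * ℓ) - 1) = n / 2 - ℓ := by field_simp
    have h3 := mul_le_mul_of_nonneg_left h1 hℓ0.le
    have h4 := Real.log_two_gt_d9
    nlinarith
  have h := ENNReal.ofReal_le_ofReal hreal
  rwa [ENNReal.ofReal_mul (by positivity), ← ENNReal.ofReal_rpow_of_nonneg hn0.le hℓ0.le,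
    ENNReal.ofReal_natCast, ENNReal.ofReal_pow (by positivity), ENNReal.ofReal_inv_of_pos two_pos,
    ENNReal.ofReal_ofNat, ← ENNReal.ofReal_rpow_of_nonneg (by positivity) hℓ0.le] at h

lemma tendsto_pow_mul_two_inv_pow (ℓ : ℕ) :
    Filter.Tendsto (fun n : ℕ => (n : ℝ≥0∞) ^ ℓ * 2⁻¹ ^ n) Filter.atTop (𝓝 0) := by
  have h := ENNReal.tendsto_ofReal (tendsto_pow_const_mul_const_pow_of_abs_lt_one ℓ
    (show |(2 : ℝ)⁻¹| < 1 by rw [abs_of_pos (by norm_num)]; norm_num))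
  rw [ENNReal.ofReal_zero] at h
  refine h.congr fun n => ?_
  rw [ENNReal.ofReal_mul (by positivity), ENNReal.ofReal_pow (by positivity),
    ENNReal.ofReal_natCast, ENNReal.ofReal_pow (by positivity), ENNReal.ofReal_inv_of_pos two_pos,
    ENNReal.ofReal_ofNat]

lemma cast_le_two_mul_mul_div {M N : ℕ} (hM : 1 ≤ M) (hN : M ≤ N) :
    (N : ℝ≥0∞) ≤ (2 * M : ℕ) * (N / M : ℕ) := by
  have h1 : 1 ≤ N / M := (Nat.one_le_div_iff hM).2 hN
  have h2 := Nat.lt_mul_div_succ N (show 0 < M from hM)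
  have h3 : N ≤ 2 * M * (N / M) := by nlinarith
  exact_mod_cast h3

lemma mem_s_of_polyDist_mul_le {E A B : Set ℂ} {f : ℂ → ℂ} {M : ℕ} (hM : 1 ≤ M)
    (hdist : ∀ n : ℕ, 1 ≤ n → polyDist E f (M * n) ≤ 3 * (polyDist A f n + polyDist B f n) +
        2 * 2⁻¹ ^ n * (supNorm A f + supNorm B f))
    (hf : ContinuousOn f E) (hfA : f ∈ s A) (hfB : f ∈ s B) (hA : supNorm A f ≠ ⊤)
    (hB : supNorm B f ≠ ⊤) : f ∈ s E := by
  refine ⟨hf, fun ℓ hℓ => ?_⟩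
  have hu : Filter.Tendsto (fun n : ℕ =>
      ((2 * M : ℕ) : ℝ≥0∞) ^ ℓ * (3 * ((n : ℝ≥0∞) ^ ℓ * polyDist A f n +
        (n : ℝ≥0∞) ^ ℓ * polyDist B f n) + 2 * (supNorm A f + supNorm B f) *
          ((n : ℝ≥0∞) ^ ℓ * 2⁻¹ ^ n))) Filter.atTop (𝓝 0) := by
    have h1 := ENNReal.Tendsto.const_mul ((hfA.2 ℓ hℓ).add (hfB.2 ℓ hℓ))
      (Or.inr (show (3 : ℝ≥0∞) ≠ ⊤ by simp))
    have h2 := ENNReal.Tendsto.const_mul (tendsto_pow_mul_two_inv_pow ℓ)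
      (Or.inr (show 2 * (supNorm A f + supNorm B f) ≠ ⊤ from
        ENNReal.mul_ne_top (by simp) (ENNReal.add_ne_top.2 ⟨hA, hB⟩)))
    have h3 := ENNReal.Tendsto.const_mul (h1.add h2)
      (Or.inr (show ((2 * M : ℕ) : ℝ≥0∞) ^ ℓ ≠ ⊤ from ENNReal.pow_ne_top (ENNReal.natCast_ne_top _)))
    simpa using h3
  refine tendsto_of_tendsto_of_tendsto_of_le_of_le' tendsto_const_nhds
    (hu.comp (Nat.tendsto_div_const_atTop (show M ≠ 0 by omega)))
    (Filter.Eventually.of_forall fun _ => zero_le) ?_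
  filter_upwards [Filter.eventually_ge_atTop M] with N hN
  have hn : 1 ≤ N / M := (Nat.one_le_div_iff hM).2 hN
  have h1 : polyDist E f N ≤ polyDist E f (M * (N / M)) :=
    polyDist_antitone E f (Nat.mul_div_le N M)
  simp only [Function.comp_apply]
  calc (N : ℝ≥0∞) ^ ℓ * polyDist E f N
      ≤ ((2 * M : ℕ) * (N / M : ℕ)) ^ ℓ * (3 * (polyDist A f (N / M) + polyDist B f (N / M)) +
        2 * 2⁻¹ ^ (N / M) * (supNorm A f + supNorm B f)) := by
        gcongr
        · exact cast_le_two_mul_mul_div hM hN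
        · exact h1.trans (hdist _ hn)
    _ = _ := by rw [mul_pow]; ring

lemma jacksonNorm_le_of_polyDist_mul_le {E A B : Set ℂ} {f : ℂ → ℂ} {M : ℕ} (hM : 1 ≤ M)
    (hdist : ∀ n : ℕ, 1 ≤ n → polyDist E f (M * n) ≤ 3 * (polyDist A f n + polyDist B f n) +
        2 * 2⁻¹ ^ n * (supNorm A f + supNorm B f))
    (hsup : supNorm E f ≤ supNorm A f + supNorm B f) {ℓ : ℝ} (hℓ : 1 ≤ ℓ) :
    jacksonNorm E ℓ f ≤
      ENNReal.ofReal ((24 * M * ℓ) ^ ℓ) * (jacksonNorm A ℓ f + jacksonNorm B ℓ f) := by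
  have hℓ0 : 0 ≤ ℓ := zero_le_one.trans hℓ
  have hM' : (1 : ℝ) ≤ M := by exact_mod_cast hM
  set J := jacksonNorm A ℓ f + jacksonNorm B ℓ f with hJ
  have hsupJ : supNorm A f + supNorm B f ≤ J := add_le_add le_self_add le_self_add
  have hdJ : ∀ n : ℕ, 1 ≤ n → (n : ℝ≥0∞) ^ ℓ * (polyDist A f n + polyDist B f n) +
      (supNorm A f + supNorm B f) ≤ J := by
    intro n hn
    have h : ∀ S : Set ℂ, supNorm S f + (n : ℝ≥0∞) ^ ℓ * polyDist S f n ≤ jacksonNorm S ℓ f :=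
      fun S => add_le_add_right
        (le_iSup₂ (f := fun (n : ℕ) (_ : 1 ≤ n) => (n : ℝ≥0∞) ^ ℓ * polyDist S f n) n hn) _
    calc _ = (supNorm A f + (n : ℝ≥0∞) ^ ℓ * polyDist A f n) +
          (supNorm B f + (n : ℝ≥0∞) ^ ℓ * polyDist B f n) := by ring
      _ ≤ J := add_le_add (h A) (h B)
  set T : ℝ≥0∞ := ENNReal.ofReal (12 * M * ℓ) ^ ℓ with hT
  have hT1 : 1 ≤ T := by
    refine ENNReal.one_le_rpow ?_ (by linarith)
    rw [ENNReal.one_le_ofReal]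
    nlinarith
  have hthree : (3 : ℝ≥0∞) ≤ 3 ^ ℓ := by
    simpa using ENNReal.rpow_le_rpow_of_exponent_le (x := (3 : ℝ≥0∞)) (by norm_num) hℓ
  have htwo : (2 : ℝ≥0∞) ≤ 2 ^ ℓ := by
    simpa using ENNReal.rpow_le_rpow_of_exponent_le (x := (2 : ℝ≥0∞)) (by norm_num) hℓ
  have hN : ∀ N : ℕ, 1 ≤ N → (N : ℝ≥0∞) ^ ℓ * polyDist E f N ≤ T * J := by
    intro N hN1
    rcases lt_or_ge N M with hNM | hNM
    -- For `N < M` the quotient `N / M` is 0 and gluing says nothing; the zero polynomial suffices.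
    · have h1 : (N : ℝ≥0∞) ≤ ENNReal.ofReal (12 * M * ℓ) := by
        rw [← ENNReal.ofReal_natCast]
        apply ENNReal.ofReal_le_ofReal
        have : (N : ℝ) ≤ M := by exact_mod_cast hNM.le
        nlinarith
      refine mul_le_mul' (ENNReal.rpow_le_rpow h1 hℓ0) ?_
      exact ((polyDist_le_supNorm E f N).trans hsup).trans hsupJ
    · have hn : 1 ≤ N / M := (Nat.one_le_div_iff hM).2 hNM
      have h1 : polyDist E f N ≤ polyDist E f (M * (N / M)) :=
        polyDist_antitone E f (Nat.mul_div_le N M)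
      set n := N / M
      set L : ℝ≥0∞ := ENNReal.ofReal (2 * ℓ) ^ ℓ with hL
      have hL1 : 1 ≤ L := by
        refine ENNReal.one_le_rpow ?_ (by linarith)
        rw [ENNReal.one_le_ofReal]
        linarith
      calc (N : ℝ≥0∞) ^ ℓ * polyDist E f N
          ≤ ((2 * M : ℕ) * (n : ℕ)) ^ ℓ * (3 * (polyDist A f n + polyDist B f n) +
            2 * 2⁻¹ ^ n * (supNorm A f + supNorm B f)) := by
            gcongr
            · exact cast_le_two_mul_mul_div hM hNM
            · exact h1.trans (hdist _ hn)
        _ = ((2 * M : ℕ) : ℝ≥0∞) ^ ℓ *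
            (3 * (1 * ((n : ℝ≥0∞) ^ ℓ * (polyDist A f n + polyDist B f n))) +
            2 * (((n : ℝ≥0∞) ^ ℓ * 2⁻¹ ^ n) * (supNorm A f + supNorm B f))) := by
            rw [ENNReal.mul_rpow_of_nonneg _ _ hℓ0]; ring
        _ ≤ ((2 * M : ℕ) : ℝ≥0∞) ^ ℓ *
            (3 * (L * ((n : ℝ≥0∞) ^ ℓ * (polyDist A f n + polyDist B f n))) +
            3 * (L * (supNorm A f + supNorm B f))) := by
            gcongr
            · norm_num
            · exact rpow_mul_two_inv_pow_le hℓ hn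
        _ = ((2 * M : ℕ) : ℝ≥0∞) ^ ℓ * 3 * L * ((n : ℝ≥0∞) ^ ℓ * (polyDist A f n + polyDist B f n) +
            (supNorm A f + supNorm B f)) := by ring
        _ ≤ ((2 * M : ℕ) : ℝ≥0∞) ^ ℓ * 3 ^ ℓ * L * J := by
            gcongr
            exact hdJ n hn
        _ = T * J := by
            rw [hL, hT, ← ENNReal.mul_rpow_of_nonneg _ _ hℓ0, ← ENNReal.mul_rpow_of_nonneg _ _ hℓ0,
              ← ENNReal.ofReal_natCast, ← ENNReal.ofReal_ofNat 3,
              ← ENNReal.ofReal_mul (by positivity), ← ENNReal.ofReal_mul (by positivity)]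
            congr 3
            push_cast
            ring
  -- The factor in `T` is `12 * M * ℓ = (2 * M) * 3 * (2 * ℓ)`; the sup norm costs a further 2,
  -- absorbed as `2 ^ ℓ`, whence `24 * M`.
  calc jacksonNorm E ℓ f ≤ J + T * J := add_le_add (hsup.trans hsupJ) (iSup₂_le hN)
    _ ≤ T * J + T * J := by
        gcongr
        exact le_mul_of_one_le_left zero_le hT1
    _ = 2 * T * J := by ring
    _ ≤ 2 ^ ℓ * T * J := by gcongr
    _ = _ := by
        rw [hT, ← ENNReal.mul_rpow_of_nonneg _ _ hℓ0, ← ENNReal.ofReal_ofNat 2,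
          ← ENNReal.ofReal_mul (by positivity), ENNReal.ofReal_rpow_of_nonneg (by positivity) hℓ0]
        congr 3
        ring

end JacksonApprox

theorem corollary4p3 (E A B : Set ℂ) (hA : IsCompact A) (hB : IsCompact B)
    (hE : E = A ∪ B) (hAB : Disjoint A B)
    (hAconv : JacksonApprox.IsPolynomiallyConvex A)
    (hBconv : JacksonApprox.IsPolynomiallyConvex B)
    (hAcap : 0 < JacksonApprox.logCapacity A)
    (hBcap : 0 < JacksonApprox.logCapacity B) :
    ∃ c : ℝ, 1 ≤ c ∧ ∀ f : ℂ → ℂ, ContinuousOn f E →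
      f ∈ JacksonApprox.s A → f ∈ JacksonApprox.s B →
        f ∈ JacksonApprox.s E ∧
        ∀ ℓ : ℝ, 1 ≤ ℓ →
          JacksonApprox.jacksonNorm E ℓ f ≤
            ENNReal.ofReal ((c * ℓ) ^ ℓ) *
              (JacksonApprox.jacksonNorm A ℓ f + JacksonApprox.jacksonNorm B ℓ f) := by
  subst hE
  have hconn := JacksonApprox.isPreconnected_compl_union hA.isClosed hB.isClosed hAB
    (JacksonApprox.isPreconnected_compl_of_isPolynomiallyConvex hA hAconv)
    (JacksonApprox.isPreconnected_compl_of_isPolynomiallyConvex hB hBconv)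
  obtain ⟨M, hM, hdist⟩ :=
    JacksonApprox.exists_polyDist_union_le hA hB hAB hconn hAcap hBcap
  have hM' : (1 : ℝ) ≤ M := by exact_mod_cast hM
  refine ⟨24 * M, by linarith, fun f hf hfA hfB => ⟨?_, fun ℓ hℓ => ?_⟩⟩
  · exact JacksonApprox.mem_s_of_polyDist_mul_le hM (hdist f) hf hfA hfB
      (JacksonApprox.supNorm_ne_top hA hfA.1) (JacksonApprox.supNorm_ne_top hB hfB.1)
  · exact JacksonApprox.jacksonNorm_le_of_polyDist_mul_le hM (hdist f)
      (JacksonApprox.supNorm_union_le A B f) hℓ
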